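/- All topological spaces and topological groups are assumed to be Hausdorff. A topological group $G$ is called $\omega$-narrow if for every neighborhood $U$ of the identity there is a countable set $C\subseteq G$ with $G=CU$. The following conditions are equivalent for an arbitrary $\omega$-narrow topological group $G$: (a) $G$ is homeomorphic to a subspace of a separable regular space; (b) $G$ is topologically isomorphic to a subgroup of a separable topological group; (c) $G$ is topologically isomorphic to a closed subgroup of a separable path-connected, locally path-connected topological group. -/

import Mathlib

universe u

/-- A topological group is `ω`-narrow if for every neighbourhood `U` of the identity it is covered
by countably many (left) translates of `U`. -/
def IsOmegaNarrow (G : Type*) [Group G] [TopologicalSpace G] : Prop :=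
  ∀ U ∈ nhds (1 : G), ∃ C : Set G, C.Countable ∧ ⋃ g ∈ C, (fun x => g * x) '' U = Set.univ

/-!
For (a) ⇒ (b): in a regular space `X` with a countable dense set `D`, the closures of subsets of `D`
contain a neighbourhood base at each point, so every subspace of `X` has character at most the
continuum `𝔠`. An `ω`-narrow group is `ω`-balanced, hence (Katz) every neighbourhood `U` of `1`
contains the preimage of a neighbourhood of `1` under a continuous homomorphism onto a
first-countable group, and that group is separable because it is again `ω`-narrow (Guran). Letting
`U` run through a neighbourhood base of size at most `𝔠` embeds `G` into a product of at most `𝔠`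
separable groups, which is separable by the Hewitt–Marczewski–Pondiczery theorem.

For (b) ⇒ (c): given a subgroup `A` of a separable group `H`, use the Hartman–Mycielski group of
step functions `[0, 1) → H` with the topology of convergence in measure. Moving the cut-off point of
a step function from `0` to `1` joins `1` to it inside any basic neighbourhood containing it, and
steps at rational points with values in a dense set generate a dense subgroup. Restricting to the
step functions whose values near `1` lie in `A` makes the copy of `A` formed by the constant
functions closed: limits of constant functions are constant, and the value of the limit is the value
near `1`.
-/

universe v

open Filter Topology Pointwise TopologicalSpace Set MeasureTheory
open scoped ENNReal Cardinal

section General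

theorem hasBasis_nhds_closure_image {ι X : Type*} [TopologicalSpace X] [RegularSpace X]
    {d : ι → X} (hd : DenseRange d) (x : X) :
    (𝓝 x).HasBasis (fun A : Set ι => closure (d '' A) ∈ 𝓝 x) fun A => closure (d '' A) := by
  refine ⟨fun U => ⟨fun hU => ?_, fun ⟨A, hA, hAU⟩ => mem_of_superset hA hAU⟩⟩
  obtain ⟨T, ⟨hT, hTc⟩, hTU⟩ := (closed_nhds_basis x).mem_iff.1 hU
  refine ⟨d ⁻¹' interior T, mem_of_superset (interior_mem_nhds.2 hT) ?_, ?_⟩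
  · rw [image_preimage_eq_inter_range]
    exact hd.open_subset_closure_inter isOpen_interior
  · calc closure (d '' (d ⁻¹' interior T)) ⊆ T :=
          closure_minimal ((image_preimage_subset _ _).trans interior_subset) hTc
      _ ⊆ U := hTU

theorem denseRange_coe_continuousMap_cantor (Y : Type*) [TopologicalSpace Y] :
    DenseRange ((⇑) : C(ℕ → Bool, Y) → (ℕ → Bool) → Y) := by
  refine dense_iff_inter_open.2 fun W hW ⟨x, hx⟩ => ?_
  obtain ⟨F, u, hu, hFu⟩ := isOpen_pi_iff.1 hW x hx
  let s : Set (ℕ → Bool) := insert default F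
  have hs : s.Finite := F.finite_toSet.insert _
  have : Finite s := hs
  obtain ⟨r, hr, -, hrc⟩ := PiNat.exists_retraction_subtype_of_isClosed hs.isClosed
    (insert_nonempty _ _)
  refine ⟨fun y => x (r y), hFu fun i hi => ?_, ⟨⟨_, ?_⟩, rfl⟩⟩
  · change x (r i) ∈ u i
    rw [hr ⟨i, mem_insert_of_mem _ hi⟩]
    exact (hu i hi).2
  · exact (continuous_of_discreteTopology (f := fun z : s => x z)).comp hrc

/-- The **Hewitt–Marczewski–Pondiczery theorem**. It reduces to a power `ℕ ^ (2 ^ ℕ)`, in which the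
continuous functions form a dense subset that is separable even for the compact-open topology. -/
theorem separableSpace_pi_of_mk_le_continuum {ι : Type*} (hι : #ι ≤ 𝔠) (X : ι → Type*)
    [∀ i, TopologicalSpace (X i)] [∀ i, SeparableSpace (X i)] : SeparableSpace (∀ i, X i) := by
  cases isEmpty_or_nonempty (∀ i, X i) with
  | inl _ => infer_instance
  | inr h =>
    have (i : ι) : Nonempty (X i) := h.map (· i)
    obtain ⟨e⟩ : Nonempty (ι ↪ (ℕ → Bool)) := Cardinal.lift_mk_le'.1 (by simpa using hι)
    have : SeparableSpace ((ℕ → Bool) → ℕ) :=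
      (denseRange_coe_continuousMap_cantor ℕ).separableSpace (by fun_prop)
    have : SeparableSpace (ι → ℕ) :=
      (e.injective.surjective_comp_right (γ := ℕ)).denseRange.separableSpace (by fun_prop)
    exact (DenseRange.piMap fun i => denseRange_denseSeq (X i)).separableSpace (by fun_prop)

theorem exists_countable_subset_forall {α : Type*} {p : Set α} {R : α → Set α → Prop}
    (hR : ∀ x, Monotone (R x)) (h : ∀ x ∈ p, ∃ s ⊆ p, s.Countable ∧ R x s) {a : α} (ha : a ∈ p) :
    ∃ s ⊆ p, s.Countable ∧ a ∈ s ∧ ∀ x ∈ s, R x s := by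
  choose! w hwp hwc hwR using h
  let t : ℕ → Set α := fun n => n.rec {a} fun _ t => ⋃ x ∈ t, w x
  have hsucc (n : ℕ) : t (n + 1) = ⋃ x ∈ t n, w x := rfl
  have htp (n : ℕ) : t n ⊆ p := by
    induction n with
    | zero => exact singleton_subset_iff.2 ha
    | succ n ih => exact iUnion₂_subset fun x hx => hwp x (ih hx)
  have htc (n : ℕ) : (t n).Countable := by
    induction n with
    | zero => exact countable_singleton a
    | succ n ih => exact ih.biUnion fun x hx => hwc x (htp n hx)
  refine ⟨⋃ n, t n, iUnion_subset htp, countable_iUnion htc, mem_iUnion.2 ⟨0, rfl⟩, fun x hx => ?_⟩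
  obtain ⟨n, hn⟩ := mem_iUnion.1 hx
  refine hR x ?_ (hwR x (htp n hn))
  exact (hsucc n ▸ subset_biUnion_of_mem hn).trans (subset_iUnion t (n + 1))

theorem separableSpace_of_subset_closure {G : Type*} [Group G] [TopologicalSpace G]
    [IsTopologicalGroup G] {S T : Set G} (hS : Subgroup.closure S = ⊤) (hT : T.Countable)
    (hST : S ⊆ closure T) : SeparableSpace G := by
  have := hT.to_subtype
  refine ⟨Subgroup.closure T, ?_, fun x => ?_⟩
  · rw [FreeGroup.closure_eq_range]
    exact countable_range (FreeGroup.lift ((↑) : T → G))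
  · suffices ⊤ ≤ (Subgroup.closure T).topologicalClosure from this (Subgroup.mem_top x)
    rw [← hS, Subgroup.closure_le]
    exact hST.trans (closure_mono Subgroup.subset_closure)

/-- The isomorphism of topological groups onto the range of an embedding. -/
noncomputable def continuousMulEquivRange {G H : Type*} [Group G] [TopologicalSpace G] [Group H]
    [TopologicalSpace H] (φ : G →* H) (hφ : IsEmbedding φ) : G ≃ₜ* φ.range where
  toMulEquiv := MonoidHom.ofInjective hφ.injective
  continuous_toFun := hφ.continuous.subtype_mk _
  continuous_invFun := hφ.continuous_iff.2 <| continuous_subtype_val.congr fun x =>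
    (MonoidHom.apply_ofInjective_symm hφ.injective x).symm

theorem exists_hom_comap_nhds_one_eq {G : Type u} [Group G] {N : Filter G} (hone : pure 1 ≤ N)
    (hmul : Tendsto (fun q : G × G => q.1 * q.2) (N ×ˢ N) N)
    (hinv : Tendsto (fun x : G => x⁻¹) N N)
    (hconj : ∀ x, Tendsto (fun y : G => x * y * x⁻¹) N N) :
    ∃ (P : Type u) (_ : Group P) (_ : TopologicalSpace P) (φ : G →* P),
      IsTopologicalGroup P ∧ T2Space P ∧ Function.Surjective φ ∧ comap φ (𝓝 1) = N := by
  let B : GroupFilterBasis G :=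
    { N.asBasis with
      one' := fun {V} hV => hone hV
      mul' := fun {V} hV => by
        obtain ⟨W, hW, hWV⟩ := N.basis_sets.prod_self.mem_iff.1 (hmul hV)
        refine ⟨W, hW, ?_⟩
        rintro _ ⟨a, ha, b, hb, rfl⟩
        exact hWV (mk_mem_prod ha hb)
      inv' := fun {V} hV => ⟨_, hinv hV, subset_rfl⟩
      conj' := fun x {V} hV => ⟨_, hconj x hV, subset_rfl⟩ }
  let : TopologicalSpace G := B.topology
  have : IsTopologicalGroup G := B.isTopologicalGroup
  refine ⟨SeparationQuotient G, inferInstance, inferInstance, SeparationQuotient.mkMonoidHom,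
    inferInstance, inferInstance, SeparationQuotient.surjective_mk, ?_⟩
  calc comap SeparationQuotient.mk (𝓝 1) = 𝓝 1 := SeparationQuotient.comap_mk_nhds_mk
    _ = N := B.nhds_one_eq.trans N.asBasis_filter

theorem finite_range_of_mem_closure {α H : Type*} [Group H] {S : Set (α → H)}
    (hS : ∀ f ∈ S, (range f).Finite) {f : α → H} (hf : f ∈ Subgroup.closure S) :
    (range f).Finite := by
  induction hf using Subgroup.closure_induction with
  | mem f hf => exact hS f hf
  | one => exact finite_range_const
  | mul f g _ _ hf hg =>
    exact (hf.mul hg).subset (range_subset_iff.2 fun t => mul_mem_mul ⟨t, rfl⟩ ⟨t, rfl⟩)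
  | inv f _ hf => exact hf.inv.subset (range_subset_iff.2 fun t => inv_mem_inv.2 ⟨t, rfl⟩)

end General

section Narrow

variable {G : Type u} [Group G] [TopologicalSpace G]

/-- A topological group is `ω`-balanced if for every neighbourhood `U` of `1` there are countably
many neighbourhoods of `1` such that every inner automorphism maps one of them into `U`. -/
def IsOmegaBalanced (G : Type*) [Group G] [TopologicalSpace G] : Prop :=
  ∀ U ∈ 𝓝 (1 : G), ∃ γ ⊆ (𝓝 (1 : G)).sets, γ.Countable ∧
    ∀ x, ∃ V ∈ γ, ∀ y ∈ V, x * y * x⁻¹ ∈ U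

namespace IsOmegaNarrow

theorem exists_countable_mul_eq_univ (hG : IsOmegaNarrow G) {U : Set G} (hU : U ∈ 𝓝 1) :
    ∃ C : Set G, C.Countable ∧ C * U = univ := by
  simpa only [iUnion_mul_left_image] using hG U hU

theorem of_surjective (hG : IsOmegaNarrow G) {P : Type*} [Group P] [TopologicalSpace P]
    {φ : G →* P} (hφ : Continuous φ) (hsurj : Function.Surjective φ) : IsOmegaNarrow P := by
  intro U hU
  obtain ⟨C, hC, hCU⟩ := hG.exists_countable_mul_eq_univ
    (hφ.continuousAt.preimage_mem_nhds (by rwa [map_one]))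
  refine ⟨φ '' C, hC.image φ, ?_⟩
  rw [iUnion_mul_left_image, ← image_preimage_eq U hsurj, ← image_mul, hCU, image_univ,
    hsurj.range_eq]

variable [IsTopologicalGroup G]

theorem isOmegaBalanced (hG : IsOmegaNarrow G) : IsOmegaBalanced G := by
  intro U hU
  have hconj : Tendsto (fun q : G × G => q.1⁻¹ * q.2 * q.1) (𝓝 1 ×ˢ 𝓝 1) (𝓝 1) := by
    have : Continuous fun q : G × G => q.1⁻¹ * q.2 * q.1 := by fun_prop
    simpa [nhds_prod_eq] using this.tendsto (1, 1)
  obtain ⟨W, hW, hWU⟩ := (𝓝 (1 : G)).basis_sets.prod_self.mem_iff.1 (hconj hU)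
  obtain ⟨C, hC, hCW⟩ := hG.exists_countable_mul_eq_univ hW
  refine ⟨(fun c => (fun y => c⁻¹ * y * c) ⁻¹' W) '' C, ?_, hC.image _, fun x => ?_⟩
  · rintro _ ⟨c, -, rfl⟩
    have : Continuous fun y => c⁻¹ * y * c := by fun_prop
    exact this.continuousAt.preimage_mem_nhds (by simpa using hW)
  · obtain ⟨c, hc, w, hw, hcw⟩ : x⁻¹ ∈ C * W := hCW ▸ mem_univ _
    refine ⟨_, mem_image_of_mem _ hc, fun y hy => ?_⟩
    have hx : x = w⁻¹ * c⁻¹ := by rw [← mul_inv_rev, ← inv_inv x, ← hcw]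
    have := hWU (mk_mem_prod hw hy)
    simpa [hx, mul_assoc] using this

theorem separableSpace [FirstCountableTopology G] (hG : IsOmegaNarrow G) : SeparableSpace G := by
  obtain ⟨b, hb⟩ := (𝓝 (1 : G)).exists_antitone_basis
  choose C hC hCb using fun n => hG.exists_countable_mul_eq_univ (hb.1.mem_of_mem (i := n) trivial)
  refine ⟨⋃ n, C n, countable_iUnion hC, fun x => mem_closure_iff_nhds.2 fun W hW => ?_⟩
  have hxW : ∀ᶠ y in 𝓝 (1 : G), x * y⁻¹ ∈ W := by
    have : Continuous fun y => x * y⁻¹ := by fun_prop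
    exact this.continuousAt.preimage_mem_nhds (by simpa using hW)
  obtain ⟨n, -, hn⟩ := hb.1.mem_iff.1 hxW
  obtain ⟨c, hc, y, hy, rfl⟩ : x ∈ C n * b n := hCb n ▸ mem_univ x
  exact ⟨c, by simpa using hn hy, mem_iUnion.2 ⟨n, hc⟩⟩

end IsOmegaNarrow

variable [IsTopologicalGroup G]

theorem IsOmegaBalanced.exists_countable_family (hG : IsOmegaBalanced G) {U : Set G}
    (hU : U ∈ 𝓝 1) :
    ∃ S ⊆ (𝓝 (1 : G)).sets, S.Countable ∧ U ∈ S ∧ ∀ V ∈ S, (∃ W ∈ S, W * W ⊆ V) ∧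
      (∃ W ∈ S, W⁻¹ ⊆ V) ∧ ∀ x, ∃ W ∈ S, ∀ y ∈ W, x * y * x⁻¹ ∈ V := by
  refine exists_countable_subset_forall (p := (𝓝 (1 : G)).sets) (R := fun V S =>
    (∃ W ∈ S, W * W ⊆ V) ∧ (∃ W ∈ S, W⁻¹ ⊆ V) ∧ ∀ x, ∃ W ∈ S, ∀ y ∈ W, x * y * x⁻¹ ∈ V) ?_ ?_ hU
  · rintro V S T hST ⟨⟨W₁, h₁, hW₁⟩, ⟨W₂, h₂, hW₂⟩, hconj⟩
    exact ⟨⟨W₁, hST h₁, hW₁⟩, ⟨W₂, hST h₂, hW₂⟩, fun x => (hconj x).imp fun W => .imp_left (@hST W)⟩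
  · intro V hV
    obtain ⟨W, hWo, hW1, hWV⟩ := exists_open_nhds_one_mul_subset hV
    obtain ⟨γ, hγ, hγc, hγV⟩ := hG V hV
    refine ⟨insert W (insert V⁻¹ γ), ?_, (hγc.insert _).insert _, ⟨W, by simp, hWV⟩,
      ⟨V⁻¹, by simp, by simp⟩, fun x => (hγV x).imp fun T => .imp_left fun hT => by simp [hT]⟩
    exact insert_subset (hWo.mem_nhds hW1) (insert_subset (inv_mem_nhds_one G hV) hγ)

theorem IsOmegaBalanced.exists_hom_firstCountable (hG : IsOmegaBalanced G) {U : Set G}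
    (hU : U ∈ 𝓝 1) :
    ∃ (P : Type u) (_ : Group P) (_ : TopologicalSpace P) (φ : G →* P),
      IsTopologicalGroup P ∧ T2Space P ∧ FirstCountableTopology P ∧ Continuous φ ∧
      Function.Surjective φ ∧ U ∈ comap φ (𝓝 1) := by
  obtain ⟨S, hS, hSc, hUS, hSV⟩ := hG.exists_countable_family hU
  have hN : 𝓝 1 ≤ generate S := le_generate_iff.2 hS
  have hmul : Tendsto (fun q : G × G => q.1 * q.2) (generate S ×ˢ generate S) (generate S) :=
    le_generate_iff.2 fun V hV => by
      obtain ⟨W, hW, hWV⟩ := (hSV V hV).1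
      exact mem_map.2 <| mem_of_superset
        (prod_mem_prod (mem_generate_of_mem hW) (mem_generate_of_mem hW))
        fun q hq => hWV (Set.mul_mem_mul hq.1 hq.2)
  have hinv : Tendsto (fun x : G => x⁻¹) (generate S) (generate S) :=
    le_generate_iff.2 fun V hV => by
      obtain ⟨W, hW, hWV⟩ := (hSV V hV).2.1
      exact mem_map.2 <| mem_of_superset (mem_generate_of_mem hW) fun x hx =>
        hWV (Set.inv_mem_inv.2 hx)
  have hconj (x : G) : Tendsto (fun y => x * y * x⁻¹) (generate S) (generate S) :=
    le_generate_iff.2 fun V hV => by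
      obtain ⟨W, hW, hWV⟩ := (hSV V hV).2.2 x
      exact mem_map.2 <| mem_of_superset (mem_generate_of_mem hW) hWV
  obtain ⟨P, _, _, φ, _, hT2, hφ, hφN⟩ :=
    exists_hom_comap_nhds_one_eq ((pure_le_nhds 1).trans hN) hmul hinv hconj
  have : (generate S).IsCountablyGenerated := ⟨S, hSc, rfl⟩
  have : (𝓝 (1 : P)).IsCountablyGenerated := by
    rw [← map_comap_of_surjective hφ (𝓝 1), hφN]
    infer_instance
  refine ⟨P, _, _, φ, inferInstance, hT2, ⟨fun x => ?_⟩, continuous_of_continuousAt_one φ ?_, hφ,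
    ?_⟩
  · rw [← map_mul_left_nhds_one x]
    infer_instance
  · rw [ContinuousAt, map_one, tendsto_iff_comap, hφN]
    exact hN
  · exact hφN ▸ mem_generate_of_mem hUS

namespace IsOmegaNarrow

theorem exists_hom_separable (hG : IsOmegaNarrow G) {U : Set G} (hU : U ∈ 𝓝 1) :
    ∃ (P : Type u) (_ : Group P) (_ : TopologicalSpace P) (φ : G →* P),
      IsTopologicalGroup P ∧ T2Space P ∧ SeparableSpace P ∧ Continuous φ ∧ U ∈ comap φ (𝓝 1) := by
  obtain ⟨P, _, _, φ, _, hT2, _, hφ, hsurj, hφU⟩ := hG.isOmegaBalanced.exists_hom_firstCountable hU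
  exact ⟨P, _, _, φ, inferInstance, hT2, (hG.of_surjective hφ hsurj).separableSpace, hφ, hφU⟩

theorem exists_isEmbedding_separable [T0Space G] (hG : IsOmegaNarrow G) {ι : Type v}
    {p : ι → Prop} {s : ι → Set G} (hs : (𝓝 (1 : G)).HasBasis p s) (hι : #ι ≤ 𝔠) :
    ∃ (H : Type max u v) (_ : Group H) (_ : TopologicalSpace H) (φ : G →* H),
      IsTopologicalGroup H ∧ T2Space H ∧ SeparableSpace H ∧ IsEmbedding φ := by
  let I := {i // p i}
  choose P _ _ φ _ _ _ hφ hφs using fun i : I => hG.exists_hom_separable (hs.mem_of_mem i.2)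
  have hΦ : Continuous (MonoidHom.pi φ) := continuous_pi hφ
  refine ⟨∀ i, P i, inferInstance, inferInstance, MonoidHom.pi φ, inferInstance, inferInstance,
    separableSpace_pi_of_mk_le_continuum ((Cardinal.mk_subtype_le p).trans hι) P,
    IsInducing.isEmbedding ?_⟩
  refine IsTopologicalGroup.isInducing_iff_nhds_one.2 (le_antisymm ?_ (hs.ge_iff.2 fun i hi => ?_))
  · simpa using (hΦ.tendsto 1).le_comap
  · have happly : Tendsto (fun x : ∀ i, P i => x ⟨i, hi⟩) (𝓝 1) (𝓝 1) :=
      (continuous_apply _).tendsto 1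
    obtain ⟨V, hV, hVs⟩ := hφs ⟨i, hi⟩
    exact ⟨_, happly hV, hVs⟩

theorem exists_isEmbedding_separable_of_isInducing [T0Space G] (hG : IsOmegaNarrow G)
    {X : Type*} [TopologicalSpace X] [RegularSpace X] [SeparableSpace X] {f : G → X}
    (hf : IsInducing f) :
    ∃ (H : Type u) (_ : Group H) (_ : TopologicalSpace H) (φ : G →* H),
      IsTopologicalGroup H ∧ T2Space H ∧ SeparableSpace H ∧ IsEmbedding φ := by
  have : Nonempty X := ⟨f 1⟩
  exact hG.exists_isEmbedding_separable
    (hf.basis_nhds (hasBasis_nhds_closure_image (denseRange_denseSeq X) (f 1)))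
    Cardinal.mk_set_nat.le

end IsOmegaNarrow

end Narrow

section ConvergenceInMeasure

variable {α H : Type*} [MeasurableSpace α] {μ : Measure α} {V W : Set H} {ε δ : ℝ≥0∞} {f g : α → H}

/-- The functions with values in `V` outside a set of measure less than `ε`. For `V` running through
the neighbourhoods of `1` and `ε > 0` these are the basic neighbourhoods of `1` in the topology of
convergence in measure. No measurability is required: `μ` is used as an outer measure. -/
def mostlyIn (μ : Measure α) (V : Set H) (ε : ℝ≥0∞) : Set (α → H) :=
  {f | μ {t | f t ∉ V} < ε}

theorem mem_mostlyIn_of_forall_notMem {s : Set α} (hs : μ s < ε) (h : ∀ t ∉ s, f t ∈ V) :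
    f ∈ mostlyIn μ V ε :=
  (measure_mono fun t ht => not_imp_comm.1 (h t) ht).trans_lt hs

theorem mem_mostlyIn_of_forall (hε : 0 < ε) (h : ∀ t, f t ∈ V) : f ∈ mostlyIn μ V ε :=
  mem_mostlyIn_of_forall_notMem (s := ∅) (by rwa [measure_empty]) fun t _ => h t

theorem exists_mem_of_mem_mostlyIn {s : Set α} (hf : f ∈ mostlyIn μ V ε) (hs : ε ≤ μ s) :
    ∃ t ∈ s, f t ∈ V := by
  by_contra! h
  exact (hs.trans (measure_mono h)).not_gt hf

theorem mostlyIn_mono (hVW : V ⊆ W) (hεδ : ε ≤ δ) : mostlyIn μ V ε ⊆ mostlyIn μ W δ :=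
  fun _ hf => mem_mostlyIn_of_forall_notMem (lt_of_lt_of_le hf hεδ) fun _ ht => hVW (not_not.1 ht)

theorem mul_mem_mostlyIn [Mul H] (hf : f ∈ mostlyIn μ V ε) (hg : g ∈ mostlyIn μ W δ) :
    f * g ∈ mostlyIn μ (V * W) (ε + δ) := by
  refine mem_mostlyIn_of_forall_notMem (s := {t | f t ∉ V} ∪ {t | g t ∉ W})
    ((measure_union_le _ _).trans_lt (ENNReal.add_lt_add hf hg)) fun t ht => ?_
  obtain ⟨htf, htg⟩ := not_or.1 ht
  exact mul_mem_mul (not_not.1 htf) (not_not.1 htg)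

theorem mulIndicator_mem_mostlyIn [One H] (hV : 1 ∈ V) (hf : f ∈ mostlyIn μ V ε) (s : Set α) :
    s.mulIndicator f ∈ mostlyIn μ V ε :=
  mem_mostlyIn_of_forall_notMem hf fun t ht =>
    (mulIndicator_eq_one_or_self s f t).elim (mem_of_eq_of_mem · hV)
      (mem_of_eq_of_mem · (not_not.1 ht))

variable [Group H] [TopologicalSpace H] [IsTopologicalGroup H]

/-- The neighbourhoods of `1` for convergence in measure in a group of functions with finite range.
Finiteness of the range makes conjugation by a function continuous: it involves only finitely many
inner automorphisms of `H`. -/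
@[reducible]
def inMeasureBasis (μ : Measure α) (S : Subgroup (α → H)) (hS : ∀ f ∈ S, (range f).Finite) :
    GroupFilterBasis S where
  sets := {T | ∃ V ∈ 𝓝 (1 : H), ∃ ε > 0, Subtype.val ⁻¹' mostlyIn μ V ε = T}
  nonempty := ⟨_, univ, univ_mem, 1, one_pos, rfl⟩
  inter_sets := by
    rintro _ _ ⟨V, hV, ε, hε, rfl⟩ ⟨W, hW, δ, hδ, rfl⟩
    refine ⟨_, ⟨V ∩ W, inter_mem hV hW, min ε δ, lt_min hε hδ, rfl⟩, fun f hf => ⟨?_, ?_⟩⟩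
    · exact mostlyIn_mono inter_subset_left (min_le_left _ _) hf
    · exact mostlyIn_mono inter_subset_right (min_le_right _ _) hf
  one' := by
    rintro _ ⟨V, hV, ε, hε, rfl⟩
    exact mem_mostlyIn_of_forall hε fun _ => mem_of_mem_nhds hV
  mul' := by
    rintro _ ⟨V, hV, ε, hε, rfl⟩
    obtain ⟨W, hWo, hW1, hWV⟩ := exists_open_nhds_one_mul_subset hV
    refine ⟨_, ⟨W, hWo.mem_nhds hW1, ε / 2, ENNReal.half_pos hε.ne', rfl⟩, ?_⟩
    rintro _ ⟨f, hf, g, hg, rfl⟩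
    exact mostlyIn_mono hWV (ENNReal.add_halves ε).le (mul_mem_mostlyIn hf hg)
  inv' := by
    rintro _ ⟨V, hV, ε, hε, rfl⟩
    exact ⟨_, ⟨V⁻¹, inv_mem_nhds_one H hV, ε, hε, rfl⟩, fun f hf => hf⟩
  conj' := by
    rintro f _ ⟨V, hV, ε, hε, rfl⟩
    refine ⟨_, ⟨⋂ h ∈ range f.1, (fun x => h * x * h⁻¹) ⁻¹' V, ?_, ε, hε, rfl⟩, fun g hg => ?_⟩
    · refine (biInter_mem (hS f f.2)).2 fun h _ => ?_
      have : Continuous fun x => h * x * h⁻¹ := by fun_prop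
      exact this.continuousAt.preimage_mem_nhds (by simpa using hV)
    · exact mem_mostlyIn_of_forall_notMem hg fun t ht =>
        mem_iInter₂.1 (not_not.1 ht) (f.1 t) (mem_range_self t)

end ConvergenceInMeasure

section Step

theorem eventually_nhdsGE_mem_Ico_iff {X : Type*} [LinearOrder X] [TopologicalSpace X]
    [OrderClosedTopology X] (a b t : X) : ∀ᶠ x in 𝓝[≥] t, (x ∈ Ico a b ↔ t ∈ Ico a b) := by
  have hle : ∀ᶠ x in 𝓝[≥] t, (a ≤ x ↔ a ≤ t) := by
    rcases le_or_gt a t with h | h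
    · filter_upwards [self_mem_nhdsWithin] with x hx using iff_of_true (h.trans hx) h
    · filter_upwards [mem_nhdsWithin_of_mem_nhds (Iio_mem_nhds h)] with x hx
      exact iff_of_false (not_le.2 hx) (not_le.2 h)
  have hlt : ∀ᶠ x in 𝓝[≥] t, (x < b ↔ t < b) := by
    rcases lt_or_ge t b with h | h
    · filter_upwards [mem_nhdsWithin_of_mem_nhds (Iio_mem_nhds h)] with x hx using iff_of_true hx h
    · filter_upwards [self_mem_nhdsWithin] with x hx
      exact iff_of_false (not_lt.2 (h.trans hx)) (not_lt.2 h)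
  filter_upwards [hle, hlt] with x h₁ h₂ using and_congr h₁ h₂

theorem eventually_volume_uIcc_lt (s : ℝ) {ε : ℝ≥0∞} (hε : 0 < ε) :
    ∀ᶠ r in 𝓝 s, volume (uIcc s r) < ε := by
  have h : Continuous fun r => ENNReal.ofReal |r - s| :=
    ENNReal.continuous_ofReal.comp (by fun_prop)
  simp only [Real.volume_interval]
  exact h.continuousAt.eventually_lt_const (by simpa using hε)

variable {H : Type*} [Group H]

/-- The step function `ℝ → H` with value `h` on `[0, s)` and `1` elsewhere. -/
noncomputable def stepFun (s : ℝ) (h : H) : ℝ → H :=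
  (Ico 0 s).mulIndicator fun _ => h

/-- The group of `H`-valued step functions on `[0, 1)`, extended by `1` to `ℝ`, that take values in
`A` near the right end `1`. The condition at `1` is what makes the group of constant functions with
value in `A` a closed subgroup. -/
def stepSubgroup (A : Subgroup H) : Subgroup (ℝ → H) :=
  Subgroup.closure {f | ∃ s h, s ≤ 1 ∧ (s < 1 ∨ h ∈ A) ∧ stepFun s h = f}

variable {A : Subgroup H} {f : ℝ → H}

theorem stepFun_mem {s : ℝ} {h : H} (hs : s ≤ 1) (hA : s < 1 ∨ h ∈ A) :
    stepFun s h ∈ stepSubgroup A :=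
  Subgroup.subset_closure ⟨s, h, hs, hA, rfl⟩

theorem mulIndicator_Iio_stepFun (r s : ℝ) (h : H) :
    (Iio r).mulIndicator (stepFun s h) = stepFun (min s r) h := by
  rw [stepFun, mulIndicator_mulIndicator, inter_comm, Ico_inter_Iio, stepFun]

theorem finite_range_of_mem_stepSubgroup (hf : f ∈ stepSubgroup A) : (range f).Finite := by
  refine finite_range_of_mem_closure ?_ hf
  rintro _ ⟨s, h, -, -, rfl⟩
  refine (toFinite {1, h}).subset <|
    range_subset_iff.2 fun t => mulIndicator_eq_one_or_self _ _ t

theorem mulIndicator_Ico_of_mem_stepSubgroup (hf : f ∈ stepSubgroup A) :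
    (Ico 0 1).mulIndicator f = f := by
  refine MonoidHom.eqOn_closure (f := mulIndicatorHom H (Ico 0 1)) (g := MonoidHom.id _) ?_ hf
  rintro _ ⟨s, h, hs, -, rfl⟩
  change (Ico 0 1).mulIndicator ((Ico 0 s).mulIndicator _) = (Ico 0 s).mulIndicator _
  rw [mulIndicator_mulIndicator, inter_eq_right.2 (Ico_subset_Ico_right hs)]

theorem eventually_eq_of_mem_stepSubgroup (hf : f ∈ stepSubgroup A) (t : ℝ) :
    ∀ᶠ x in 𝓝[≥] t, f x = f t := by
  induction hf using Subgroup.closure_induction with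
  | mem f hf =>
    obtain ⟨s, h, -, -, rfl⟩ := hf
    filter_upwards [eventually_nhdsGE_mem_Ico_iff 0 s t] with x hx
    simp only [stepFun, mulIndicator, hx]
  | one => exact .of_forall fun _ => rfl
  | mul f g _ _ hf hg => filter_upwards [hf, hg] with x hfx hgx using congrArg₂ (· * ·) hfx hgx
  | inv f _ hf => filter_upwards [hf] with x hfx using congrArg (·⁻¹) hfx

theorem eventually_mem_of_mem_stepSubgroup (hf : f ∈ stepSubgroup A) :
    ∀ᶠ x in 𝓝[<] (1 : ℝ), f x ∈ A := by
  induction hf using Subgroup.closure_induction with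
  | mem f hf =>
    obtain ⟨s, h, -, hs | hA, rfl⟩ := hf
    · filter_upwards [mem_nhdsWithin_of_mem_nhds (Ioi_mem_nhds hs)] with x hx
      rw [stepFun, mulIndicator_of_notMem fun h => lt_asymm hx h.2]
      exact A.one_mem
    · exact .of_forall fun x =>
        (mulIndicator_eq_one_or_self _ _ x).elim (mem_of_eq_of_mem · A.one_mem)
          (mem_of_eq_of_mem · hA)
  | one => exact .of_forall fun _ => A.one_mem
  | mul f g _ _ hf hg => filter_upwards [hf, hg] with x hfx hgx using A.mul_mem hfx hgx
  | inv f _ hf => filter_upwards [hf] with x hfx using A.inv_mem hfx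

theorem mulIndicator_Iio_mem_stepSubgroup (hf : f ∈ stepSubgroup A) (r : ℝ) :
    (Iio r).mulIndicator f ∈ stepSubgroup A := by
  suffices stepSubgroup A ≤ (stepSubgroup A).comap (mulIndicatorHom H (Iio r)) from this hf
  refine (Subgroup.closure_le _).2 ?_
  rintro _ ⟨s, h, hs, hA, rfl⟩
  change (Iio r).mulIndicator (stepFun s h) ∈ stepSubgroup A
  rw [mulIndicator_Iio_stepFun]
  exact stepFun_mem (min_le_of_left_le hs) (hA.imp_left (min_le_left s r).trans_lt)

end Step

/-- The Hartman–Mycielski group of `H` relative to the subgroup `A`: a synonym of `stepSubgroup A`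
which carries the topology of convergence in measure instead of that of pointwise convergence. -/
def StepGroup {H : Type*} [Group H] (A : Subgroup H) : Type _ := stepSubgroup A

namespace StepGroup

variable {H : Type*} [Group H] {A : Subgroup H}

instance : Group (StepGroup A) := inferInstanceAs (Group (stepSubgroup A))

instance : CoeFun (StepGroup A) fun _ => ℝ → H := ⟨fun f => f.1⟩

@[ext]
theorem ext {f g : StepGroup A} (h : ∀ t, f t = g t) : f = g :=
  Subtype.ext (funext h)

@[simp]
theorem one_apply (t : ℝ) : (1 : StepGroup A) t = 1 := rfl

theorem apply_of_notMem (f : StepGroup A) {t : ℝ} (ht : t ∉ Ico 0 1) : f t = 1 := by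
  rw [← mulIndicator_Ico_of_mem_stepSubgroup f.2, mulIndicator_of_notMem ht]

/-- `stepFun s h` as an element of `StepGroup A`. -/
noncomputable def step {s : ℝ} {h : H} (hs : s ≤ 1) (hA : s < 1 ∨ h ∈ A) : StepGroup A :=
  ⟨stepFun s h, stepFun_mem hs hA⟩

theorem closure_step_eq_top :
    Subgroup.closure {f : StepGroup A | ∃ (s : ℝ) (h : H) (hs : s ≤ 1) (hA : s < 1 ∨ h ∈ A),
      step hs hA = f} = ⊤ := by
  refine top_unique (Subgroup.closure_closure_coe_preimage.ge.trans (Subgroup.closure_mono ?_))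
  rintro _ ⟨s, h, hs, hA, hf⟩
  exact ⟨s, h, hs, hA, Subtype.ext hf⟩

/-- The restriction of `f` to `(-∞, s)`, extended by `1`. As `s` runs from `0` to `1` these form a
path from `1` to `f`. -/
noncomputable def cut (s : ℝ) (f : StepGroup A) : StepGroup A :=
  ⟨(Iio s).mulIndicator f, mulIndicator_Iio_mem_stepSubgroup f.2 s⟩

theorem cut_apply (s : ℝ) (f : StepGroup A) (t : ℝ) : cut s f t = (Iio s).mulIndicator f t := rfl

@[simp]
theorem cut_zero (f : StepGroup A) : cut 0 f = 1 := by
  ext t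
  refine mulIndicator_apply_eq_one.2 fun ht => f.apply_of_notMem fun h => ?_
  exact h.1.not_gt ht

@[simp]
theorem cut_one (f : StepGroup A) : cut 1 f = f := by
  ext t
  refine mulIndicator_apply_eq_self.2 fun ht => f.apply_of_notMem fun h => ht h.2

/-- The embedding of `A` into `StepGroup A` as the functions that are constant on `[0, 1)`. -/
noncomputable def const (A : Subgroup H) : A →* StepGroup A where
  toFun a := step le_rfl (Or.inr a.2)
  map_one' := Subtype.ext (mulIndicator_one H (Ico 0 1))
  map_mul' a b := Subtype.ext (mulIndicator_mul (Ico 0 1) (fun _ => (a : H)) fun _ => b)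

theorem const_apply (a : A) (t : ℝ) : const A a t = (Ico 0 1).mulIndicator (fun _ => (a : H)) t :=
  rfl

theorem const_apply_of_mem (a : A) {t : ℝ} (ht : t ∈ Ico 0 1) : const A a t = a := by
  rw [const_apply, mulIndicator_of_mem ht]

theorem const_injective : Function.Injective (const A) := fun a b hab => by
  have h0 : (0 : ℝ) ∈ Ico 0 1 := by simp
  rw [← Subtype.coe_inj, ← const_apply_of_mem a h0, hab, const_apply_of_mem b h0]

variable [TopologicalSpace H] [IsTopologicalGroup H]

noncomputable instance : TopologicalSpace (StepGroup A) :=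
  (inMeasureBasis volume (stepSubgroup A) fun _ => finite_range_of_mem_stepSubgroup).topology

instance : IsTopologicalGroup (StepGroup A) :=
  (inMeasureBasis volume (stepSubgroup A) fun _ =>
    finite_range_of_mem_stepSubgroup).isTopologicalGroup

theorem hasBasis_nhds_one : (𝓝 (1 : StepGroup A)).HasBasis
    (fun p : Set H × ℝ≥0∞ => p.1 ∈ 𝓝 1 ∧ 0 < p.2)
    fun p => {f | ⇑f ∈ mostlyIn volume p.1 p.2} := by
  refine ⟨fun S => ((inMeasureBasis volume (stepSubgroup A) fun _ =>
    finite_range_of_mem_stepSubgroup).nhds_one_hasBasis.mem_iff).trans ⟨?_, ?_⟩⟩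
  · rintro ⟨_, ⟨V, hV, ε, hε, rfl⟩, h⟩
    exact ⟨(V, ε), ⟨hV, hε⟩, h⟩
  · rintro ⟨⟨V, ε⟩, ⟨hV, hε⟩, h⟩
    exact ⟨_, ⟨V, hV, ε, hε, rfl⟩, h⟩

theorem hasBasis_nhds (f : StepGroup A) : (𝓝 f).HasBasis
    (fun p : Set H × ℝ≥0∞ => p.1 ∈ 𝓝 1 ∧ 0 < p.2)
    fun p => {g | ⇑(g / f) ∈ mostlyIn volume p.1 p.2} :=
  hasBasis_nhds_one.nhds_of_one f

theorem eventually_exists_mem_Ico (f : StepGroup A) {s b : ℝ} (hsb : s < b) {P : Set H}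
    (hP : P ∈ 𝓝 (f s)) : ∀ᶠ g in 𝓝 f, ∃ x ∈ Ico s b, g x ∈ P := by
  obtain ⟨c, hc, hfc⟩ := (mem_nhdsGE_iff_exists_mem_Ioc_Ico_subset hsb).1
    (eventually_eq_of_mem_stepSubgroup f.2 s)
  have hV : (· * f s) ⁻¹' P ∈ 𝓝 1 :=
    (continuous_mul_const (f s)).continuousAt.preimage_mem_nhds (by rwa [one_mul])
  have hε : 0 < ENNReal.ofReal (c - s) := ENNReal.ofReal_pos.2 (sub_pos.2 hc.1)
  filter_upwards [(hasBasis_nhds f).mem_of_mem (i := (_, _)) ⟨hV, hε⟩] with g hg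
  obtain ⟨x, hx, hgx⟩ := exists_mem_of_mem_mostlyIn hg (Real.volume_Ico (a := s) (b := c)).ge
  refine ⟨x, Ico_subset_Ico_right hc.2 hx, ?_⟩
  have hfx : f x = f s := hfc hx
  have hgP : g x / f x * f s ∈ P := hgx
  rwa [hfx, div_mul_cancel] at hgP

instance [T1Space H] : T2Space (StepGroup A) := by
  refine IsTopologicalGroup.t2Space_of_one_sep fun f hf => ?_
  obtain ⟨t, ht⟩ : ∃ t, f t ≠ 1 := by
    by_contra! h
    exact hf (ext h)
  obtain ⟨b, hb, hfb⟩ := mem_nhdsGE_iff_exists_Ico_subset.1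
    (eventually_eq_of_mem_stepSubgroup f.2 t)
  refine ⟨_, eventually_exists_mem_Ico 1 hb (isOpen_compl_singleton.mem_nhds ht.symm), ?_⟩
  rintro ⟨x, hx, hfx⟩
  exact hfx (hfb hx)

theorem continuous_cut (f : StepGroup A) : Continuous fun s => cut s f := by
  refine continuous_iff_continuousAt.2 fun s => (hasBasis_nhds _).tendsto_right_iff.2 ?_
  rintro ⟨V, ε⟩ ⟨hV, hε⟩
  filter_upwards [eventually_volume_uIcc_lt s hε] with r hr
  refine mem_mostlyIn_of_forall_notMem hr fun t ht => ?_
  have hrs : t ∈ Iio r ↔ t ∈ Iio s := by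
    simp only [mem_Iio]
    rw [mem_uIcc] at ht
    grind
  have : (cut r f / cut s f) t = 1 := by
    classical exact div_eq_one.2 (by simp only [cut_apply, mulIndicator_apply, hrs])
  exact mem_of_eq_of_mem this (mem_of_mem_nhds hV)

theorem isPathConnected_setOf_div_mem_mostlyIn (f : StepGroup A) {V : Set H} (hV : 1 ∈ V)
    {ε : ℝ≥0∞} (hε : 0 < ε) :
    IsPathConnected {g : StepGroup A | ⇑(g / f) ∈ mostlyIn volume V ε} := by
  refine ⟨f, mem_mostlyIn_of_forall hε fun t => by simpa using hV, fun {g} hg => ?_⟩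
  refine JoinedIn.ofLine (f := fun s => cut s (g / f) * f)
    ((continuous_cut _).mul continuous_const).continuousOn (by simp) (by simp) ?_
  rintro _ ⟨s, -, rfl⟩
  change ⇑(cut s (g / f) * f / f) ∈ mostlyIn volume V ε
  rw [mul_div_cancel_right]
  exact mulIndicator_mem_mostlyIn hV hg (Iio s)

instance : LocallyPathConnectedSpace (StepGroup A) :=
  .of_bases hasBasis_nhds fun f _ hp =>
    isPathConnected_setOf_div_mem_mostlyIn f (mem_of_mem_nhds hp.1) hp.2

instance : PathConnectedSpace (StepGroup A) := by
  have huniv : {g : StepGroup A | ⇑(g / 1) ∈ mostlyIn volume univ 1} = univ :=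
    eq_univ_of_forall fun _ => mem_mostlyIn_of_forall one_pos fun _ => mem_univ _
  rw [pathConnectedSpace_iff_univ, ← huniv]
  exact isPathConnected_setOf_div_mem_mostlyIn 1 (mem_univ 1) one_pos

theorem step_mem_closure_rat {D : Set H} (hD : Dense D) {s : ℝ} {h : H} (hs : s ≤ 1)
    (hA : s < 1 ∨ h ∈ A) :
    step hs hA ∈ closure (range fun p : {q : ℚ // (q : ℝ) < 1} × D =>
      step (A := A) (h := p.2) p.1.2.le (Or.inl p.1.2)) := by
  refine (mem_closure_iff_nhds_basis (hasBasis_nhds _)).2 ?_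
  rintro ⟨V, ε⟩ ⟨hV, hε⟩
  obtain ⟨q, hqs, hqε⟩ : ∃ q : ℚ, (q : ℝ) < s ∧ volume (uIcc s q) < ε := by
    obtain ⟨l, u, hlu, hε⟩ := mem_nhds_iff_exists_Ioo_subset.1 (eventually_volume_uIcc_lt s hε)
    obtain ⟨q, hlq, hqs⟩ := exists_rat_btwn hlu.1
    exact ⟨q, hqs, hε ⟨hlq, hqs.trans hlu.2⟩⟩
  obtain ⟨d, hdD, hdV⟩ : (D ∩ {d | d / h ∈ V}).Nonempty := by
    have : Continuous fun d : H => d / h := by fun_prop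
    exact hD.inter_nhds_nonempty (x := h) (this.continuousAt.preimage_mem_nhds (by simpa using hV))
  refine ⟨_, ⟨(⟨q, hqs.trans_le hs⟩, ⟨d, hdD⟩), rfl⟩, ?_⟩
  refine mem_mostlyIn_of_forall_notMem hqε fun t ht => ?_
  have htqs : t ∈ Ico 0 (q : ℝ) ↔ t ∈ Ico 0 s := by
    rw [uIcc_of_ge hqs.le, mem_Icc] at ht
    grind
  change stepFun q d t / stepFun s h t ∈ V
  by_cases hts : t ∈ Ico 0 s
  · simpa [stepFun, hts, htqs] using hdV
  · simpa [stepFun, hts, htqs] using mem_of_mem_nhds hV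

instance [SeparableSpace H] : SeparableSpace (StepGroup A) := by
  obtain ⟨D, hD, hDd⟩ := exists_countable_dense H
  have := hD.to_subtype
  refine separableSpace_of_subset_closure closure_step_eq_top (countable_range
    fun p : {q : ℚ // (q : ℝ) < 1} × D => step (h := (p.2 : H)) p.1.2.le (Or.inl p.1.2)) ?_
  rintro _ ⟨s, h, hs, hA, rfl⟩
  exact step_mem_closure_rat hDd hs hA

theorem isEmbedding_const : IsEmbedding (const A) := by
  refine ⟨IsTopologicalGroup.isInducing_iff_nhds_one.2 (le_antisymm ?_ ?_), const_injective⟩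
  · refine (hasBasis_nhds_one.comap _).ge_iff.2 ?_
    rintro ⟨V, ε⟩ ⟨hV, hε⟩
    filter_upwards [continuous_subtype_val.tendsto (1 : A) hV] with a ha
    refine mem_mostlyIn_of_forall hε fun t => ?_
    rcases mulIndicator_eq_one_or_self (Ico 0 1) (fun _ => (a : H)) t with h | h
    · exact mem_of_eq_of_mem h (mem_of_mem_nhds hV)
    · exact mem_of_eq_of_mem h ha
  · rw [nhds_subtype_eq_comap]
    rintro _ ⟨V, hV, hVS⟩
    refine ⟨_, eventually_exists_mem_Ico 1 zero_lt_one hV, ?_⟩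
    rintro a ⟨x, hx, hax⟩
    exact hVS (by rwa [const_apply_of_mem a hx] at hax)

theorem apply_eq_of_mem_closure_range_const [T2Space H] {f : StepGroup A}
    (hf : f ∈ closure (range (const A))) {s t : ℝ} (hs : s ∈ Ico 0 1) (ht : t ∈ Ico 0 1) :
    f s = f t := by
  by_contra hne
  obtain ⟨P, Q, hP, hQ, hPQ⟩ := t2_separation_nhds hne
  obtain ⟨_, ⟨⟨x, hx, hxP⟩, ⟨y, hy, hyQ⟩⟩, a, rfl⟩ := mem_closure_iff_nhds.1 hf _
    (inter_mem (f.eventually_exists_mem_Ico hs.2 hP) (f.eventually_exists_mem_Ico ht.2 hQ))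
  rw [const_apply_of_mem a (Ico_subset_Ico_left hs.1 hx)] at hxP
  rw [const_apply_of_mem a (Ico_subset_Ico_left ht.1 hy)] at hyQ
  exact disjoint_left.1 hPQ hxP hyQ

theorem isClosed_range_const [T2Space H] : IsClosed (range (const A)) := by
  refine isClosed_of_closure_subset fun f hf => ?_
  obtain ⟨x, hxA, hx⟩ := ((eventually_mem_of_mem_stepSubgroup f.2).and
    (Ico_mem_nhdsLT (zero_lt_one' ℝ))).exists
  refine ⟨⟨f x, hxA⟩, ext fun t => ?_⟩
  by_cases ht : t ∈ Ico 0 1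
  · rw [const_apply_of_mem _ ht]
    exact apply_eq_of_mem_closure_range_const hf hx ht
  · rw [apply_of_notMem _ ht, apply_of_notMem _ ht]

end StepGroup

theorem mainTheorem7 (G : Type u) [Group G] [TopologicalSpace G] [IsTopologicalGroup G]
    [T2Space G] (hG : IsOmegaNarrow G) :
    List.TFAE [
      -- `G` is homeomorphic to a subspace of a separable regular (Hausdorff) space
      ∃ (X : Type u) (_ : TopologicalSpace X), T3Space X ∧ TopologicalSpace.SeparableSpace X ∧
        ∃ S : Set X, Nonempty (G ≃ₜ S),
      -- `G` is topologically isomorphic to a subgroup of a separable topological group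
      ∃ (H : Type u) (_ : Group H) (_ : TopologicalSpace H),
        IsTopologicalGroup H ∧ T2Space H ∧ TopologicalSpace.SeparableSpace H ∧
        ∃ K : Subgroup H, Nonempty (G ≃ₜ* K),
      -- `G` is topologically isomorphic to a closed subgroup of a separable path-connected,
      -- locally path-connected topological group
      ∃ (H : Type u) (_ : Group H) (_ : TopologicalSpace H),
        IsTopologicalGroup H ∧ T2Space H ∧ TopologicalSpace.SeparableSpace H ∧
        PathConnectedSpace H ∧ LocallyPathConnectedSpace H ∧
        ∃ K : Subgroup H, IsClosed (K : Set H) ∧ Nonempty (G ≃ₜ* K)] := by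
  tfae_have 1 → 2 := by
    rintro ⟨X, _, _, _, S, ⟨e⟩⟩
    obtain ⟨H, _, _, φ, hgroup, hT2, hsep, hφ⟩ := hG.exists_isEmbedding_separable_of_isInducing
      (IsInducing.subtypeVal.comp e.isInducing)
    exact ⟨H, _, _, hgroup, hT2, hsep, φ.range, ⟨continuousMulEquivRange φ hφ⟩⟩
  tfae_have 2 → 3 := by
    rintro ⟨H, _, _, _, _, _, A, ⟨e⟩⟩
    let e' := continuousMulEquivRange (StepGroup.const A) StepGroup.isEmbedding_const
    exact ⟨StepGroup A, inferInstance, inferInstance, inferInstance, inferInstance, inferInstance,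
      inferInstance, inferInstance, _, StepGroup.isClosed_range_const, ⟨e.trans e'⟩⟩
  tfae_have 3 → 1 := by
    rintro ⟨H, _, _, _, _, hsep, _, _, K, _, ⟨e⟩⟩
    exact ⟨H, _, inferInstance, hsep, K, ⟨e.toHomeomorph⟩⟩
  tfae_finish
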